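/- Notation. For an $n\times n$ complex matrix $X$ write $|X|=\sqrt{X^\dagger X}$, $\|X\|_1=\operatorname{Tr}|X|$, and, for $X$ invertible, $\operatorname{sign}X=X|X|^{-1}$. Let $\operatorname{vec}$ stack the columns of a matrix, let $K$ be the commutation matrix, $K\operatorname{vec}X=\operatorname{vec}X^T$, that is $K=\sum_{i,j}J^{ji}\otimes J^{ij}$ with $J^{ij}$ the single-entry matrices, let $A\oplus B=A\otimes 1+1\otimes B$ and $X_\oplus=X^T\oplus X$. For a (real-)differentiable function $F(X,X^*)$ of an unpatterned complex matrix, with values in scalars or in column vectors, let $D_XF=\partial F/\partial\operatorname{vec}^TX$ and $D_{X^*}F=\partial F/\partial\operatorname{vec}^TX^*$ be its Wirtinger Jacobians, so that $dF=(D_XF)\,d\operatorname{vec}X+(D_{X^*}F)\,d\operatorname{vec}X^*$. The derivative with respect to a Hermitian argument $A$ is $D_AF=[D_XF+(D_{X^*}F)K]_{X=A}$, and the Hermitian-patterned Hessian of a scalar function $g$ is $$\mathscr H_{A,A}(g)=D_A(D_Ag)^T=D_A\big[(D_Xg+(D_{X^*}g)K)^T\big].$$ Theorem. Let $A$ be an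 invertible Hermitian $n\times n$ matrix. Then the trace norm is real-differentiable in a neighbourhood of $A$ in the space of all complex matrices, $D_X\|X\|_1$ and $D_{X^*}\|X\|_1$ are real-differentiable at $A$, and the following hold. 1. For every eigendecomposition $A=U\Lambda U^\dagger$ with $U$ unitary and $\Lambda$ real diagonal, $|\Lambda|$ and $|\Lambda|\oplus|\Lambda|$ are invertible and $$\mathscr H_{A,A}(\|A\|_1)=K(U^*\otimes U)\,[1-\operatorname{sign}\Lambda\otimes\operatorname{sign}\Lambda]\,(|\Lambda|\oplus|\Lambda|)^{-1}(U^T\otimes U^\dagger),$$ where $U^*$ is the entrywise complex conjugate of $U$. 2. $|A|$ and $|A|_\oplus$ are invertible and $$\mathscr H_{A,A}(\|A\|_1)=\tfrac12K\Big[(|A|^{-1})_\oplus-A_\oplus(|A|_\oplus)^{-1}(|A|^{-1})_\oplus(|A|_\oplus)^{-1}A_\oplus\Big].$$ 3. If all eigenvalues of $A$ are positive, then $\mathscr H_{A,A}(\|A\|_1)=0$. -/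

import Mathlib

open scoped Matrix Kronecker MatrixOrder ComplexOrder

noncomputable section

namespace TraceNormHessian

variable {ι : Type*} [Fintype ι] [DecidableEq ι]

/-- The absolute value `|X| = √(X† X)`, the square root being the positive semidefinite one. -/
def matAbs (X : Matrix ι ι ℂ) : Matrix ι ι ℂ := CFC.sqrt (Xᴴ * X)

/-- The trace norm `‖X‖₁ = Tr √(X† X)`. -/
def traceNorm (X : Matrix ι ι ℂ) : ℝ := (Matrix.trace (matAbs X)).re

/-- The matrix sign `sign X = X |X|⁻¹` of an invertible matrix, so that `X = (sign X) |X|`. -/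
def matSign (X : Matrix ι ι ℂ) : Matrix ι ι ℂ := X * (matAbs X)⁻¹

/-- The commutation matrix `K = ∑ i j, J^{ji} ⊗ J^{ij}`, where `J^{ij}` are the single-entry
matrices. As everywhere below, the index set `ι × ι` of vectorized matrices is that of the
column-stacking `Matrix.vec`, so that `K (vec X) = vec Xᵀ`. -/
def commMatrix (ι : Type*) [Fintype ι] [DecidableEq ι] : Matrix (ι × ι) (ι × ι) ℂ :=
  ∑ i : ι, ∑ j : ι, Matrix.single j i (1 : ℂ) ⊗ₖ Matrix.single i j (1 : ℂ)

/-- The Kronecker sum `A ⊕ B = A ⊗ 1 + 1 ⊗ B`. -/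
def kronSum (A B : Matrix ι ι ℂ) : Matrix (ι × ι) (ι × ι) ℂ :=
  A ⊗ₖ (1 : Matrix ι ι ℂ) + (1 : Matrix ι ι ℂ) ⊗ₖ B

/-- `X_⊕ = Xᵀ ⊕ X = Xᵀ ⊗ 1 + 1 ⊗ X`. -/
def kronSelf (X : Matrix ι ι ℂ) : Matrix (ι × ι) (ι × ι) ℂ := kronSum Xᵀ X

/-- The unpatterned Jacobian `D_X F = ∂F / ∂ vecᵀ X` of a vector-valued function `F` of an
unpatterned complex matrix. Its column indexed by the entry `X i j` (position `(j, i)` of `vec X`)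
is the Wirtinger derivative `½ (∂F/∂(Re X i j) - 𝐢 ∂F/∂(Im X i j))`. -/
def jacX {κ : Type*} (F : Matrix ι ι ℂ → κ → ℂ) (X : Matrix ι ι ℂ) : Matrix κ (ι × ι) ℂ :=
  Matrix.of fun k p => (1 / 2 : ℂ) *
    (fderiv ℝ F X (Matrix.single p.2 p.1 1) k
      - Complex.I * fderiv ℝ F X (Matrix.single p.2 p.1 Complex.I) k)

/-- The unpatterned Jacobian `D_{X*} F = ∂F / ∂ vecᵀ X*`, whose column indexed by the entry `X i j`
is the conjugate Wirtinger derivative `½ (∂F/∂(Re X i j) + 𝐢 ∂F/∂(Im X i j))`. -/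
def jacXconj {κ : Type*} (F : Matrix ι ι ℂ → κ → ℂ) (X : Matrix ι ι ℂ) : Matrix κ (ι × ι) ℂ :=
  Matrix.of fun k p => (1 / 2 : ℂ) *
    (fderiv ℝ F X (Matrix.single p.2 p.1 1) k
      + Complex.I * fderiv ℝ F X (Matrix.single p.2 p.1 Complex.I) k)

/-- The derivative `D_A F = [D_X F + (D_{X*} F) K]_{X = A}` with respect to a Hermitian
argument `A`. -/
def hermJac {κ : Type*} (F : Matrix ι ι ℂ → κ → ℂ) (A : Matrix ι ι ℂ) : Matrix κ (ι × ι) ℂ :=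
  jacX F A + jacXconj F A * commMatrix ι

/-- A real scalar function, regarded as a complex vector function with one component. -/
def scalarFun (g : Matrix ι ι ℂ → ℝ) : Matrix ι ι ℂ → Unit → ℂ := fun X _ => (g X : ℂ)

/-- The transposed derivative `(D_X g)ᵀ` of a scalar function, as a vector-valued function of the
matrix. -/
def gradX (g : Matrix ι ι ℂ → ℝ) (X : Matrix ι ι ℂ) : ι × ι → ℂ := jacX (scalarFun g) X ()

/-- `(D_{X*} g)ᵀ`, as a vector-valued function of the matrix. -/
def gradXconj (g : Matrix ι ι ℂ → ℝ) (X : Matrix ι ι ℂ) : ι × ι → ℂ :=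
  jacXconj (scalarFun g) X ()

/-- `(D_A g)ᵀ = [D_X g + (D_{X*} g) K]ᵀ`, as a vector-valued function of the matrix. -/
def hermGrad (g : Matrix ι ι ℂ → ℝ) (X : Matrix ι ι ℂ) : ι × ι → ℂ := hermJac (scalarFun g) X ()

/-- The Hessian `ℋ_{A,A}(g) = D_A (D_A g)ᵀ` of a scalar function with respect to a Hermitian
argument `A`. -/
def hermHessian (g : Matrix ι ι ℂ → ℝ) (A : Matrix ι ι ℂ) : Matrix (ι × ι) (ι × ι) ℂ :=
  hermJac (hermGrad g) A

/-- The derivatives that enter `hermHessian g A` exist: `g` is (real) differentiable near `A`, and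
`D_X g` and `D_{X*} g` are (real) differentiable at `A`. -/
def TwiceDifferentiableAt (g : Matrix ι ι ℂ → ℝ) (A : Matrix ι ι ℂ) : Prop :=
  (∀ᶠ X in nhds A, DifferentiableAt ℝ g X) ∧
    DifferentiableAt ℝ (gradX g) A ∧ DifferentiableAt ℝ (gradXconj g) A

end TraceNormHessian

end

noncomputable section

namespace TraceNormHessian

variable {ι : Type*} [Fintype ι] [DecidableEq ι]

open Matrix
open scoped Matrix.Norms.L2Operator

/-! ### The absolute value of a matrix -/

/-! The absolute value is the positive root of `P * P = Xᴴ * X`. The derivative of squaring at `P`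
is the Sylvester operator `E ↦ P E + E P`, which on `vec E` is the matrix `kronSelf P`, positive
definite with `P`. For invertible `X` the inverse function theorem thus makes `|X|` and `sign X`
real-differentiable, and `d‖X‖₁ = Re tr((sign X)† dX)` (`fderiv_traceNorm`). The Hermitian gradient
is then the Hermitian part of `sign X`. On Hermitian directions `hermJac` is the Fréchet derivative,
and such directions span, so the Hessian at `A` is determined by the derivative `T` of the sign
along Hermitian `E`. With `S = sign A` it solves `|A| T + T |A| = E - S E S` (`matSign_sylvester`).
Vectorizing gives `K (|A|_⊕)⁻¹ (1 - Sᵀ ⊗ S)` (`hermHessian_traceNorm`). Both formulas follow by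
diagonalizing with `U* ⊗ U` and comparing entries; if `A` is positive, then `S = 1` and the Hessian
vanishes. -/

theorem matAbs_posSemidef (X : Matrix ι ι ℂ) : (matAbs X).PosSemidef :=
  Matrix.nonneg_iff_posSemidef.1 (CFC.sqrt_nonneg _)

theorem matAbs_isHermitian (X : Matrix ι ι ℂ) : (matAbs X)ᴴ = matAbs X :=
  (matAbs_posSemidef X).isHermitian

theorem matAbs_mul_self (X : Matrix ι ι ℂ) : matAbs X * matAbs X = Xᴴ * X :=
  CFC.sqrt_mul_sqrt_self _ (star_mul_self_nonneg X)

theorem matAbs_eq_of_mul_self {X P : Matrix ι ι ℂ} (hP : P.PosSemidef) (h : P * P = Xᴴ * X) :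
    matAbs X = P :=
  CFC.sqrt_unique h (Matrix.nonneg_iff_posSemidef.2 hP)

theorem isUnit_matAbs {X : Matrix ι ι ℂ} (hX : IsUnit X) : IsUnit (matAbs X) := by
  have h : IsUnit (matAbs X * matAbs X) := by
    rw [matAbs_mul_self]
    exact hX.star.mul hX
  rw [Matrix.isUnit_iff_isUnit_det] at h ⊢
  rw [Matrix.det_mul] at h
  exact isUnit_of_mul_isUnit_left h

theorem matAbs_posDef {X : Matrix ι ι ℂ} (hX : IsUnit X) : (matAbs X).PosDef :=
  (matAbs_posSemidef X).posDef_iff_isUnit.2 (isUnit_matAbs hX)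

theorem continuous_matAbs : Continuous (matAbs : Matrix ι ι ℂ → Matrix ι ι ℂ) :=
  CFC.continuous_abs

theorem matSign_mul_matAbs {X : Matrix ι ι ℂ} (hX : IsUnit X) : matSign X * matAbs X = X :=
  Matrix.nonsing_inv_mul_cancel_right _ _
    ((Matrix.isUnit_iff_isUnit_det _).1 (isUnit_matAbs hX))

/-! ### Kronecker sums -/

theorem kronSelf_mulVec_vec (P E : Matrix ι ι ℂ) :
    kronSelf P *ᵥ vec E = vec (P * E + E * P) := by
  rw [kronSelf, kronSum, Matrix.add_mulVec, kronecker_mulVec_vec, kronecker_mulVec_vec,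
    Matrix.vec_add, add_comm]
  simp

theorem kronSelf_posDef {P : Matrix ι ι ℂ} (hP : P.PosDef) : (kronSelf P).PosDef :=
  (hP.transpose.kronecker Matrix.PosDef.one).add (Matrix.PosDef.one.kronecker hP)

/-- Uniqueness for the Sylvester equation: it makes the derivative of squaring invertible and later
forces the derivative of the sign to be Hermitian. -/
theorem eq_zero_of_mul_add_mul_eq_zero {P E : Matrix ι ι ℂ} (hP : P.PosDef)
    (h : P * E + E * P = 0) : E = 0 := by
  have h1 : kronSelf P *ᵥ vec E = 0 := by rw [kronSelf_mulVec_vec, h, Matrix.vec_zero]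
  have h2 := Matrix.mulVec_injective_of_isUnit (kronSelf_posDef hP).isUnit
  exact Matrix.vec_eq_zero_iff.1 (h2 (by rw [h1, Matrix.mulVec_zero]))

/-! ### Differentiability -/

/-- The Sylvester operator `E ↦ P E + E P`, as a real-linear endomorphism. -/
def sylvesterCLM (P : Matrix ι ι ℂ) : Matrix ι ι ℂ →L[ℝ] Matrix ι ι ℂ :=
  LinearMap.toContinuousLinearMap
    (LinearMap.mulLeft ℝ P + LinearMap.mulRight ℝ P : Matrix ι ι ℂ →ₗ[ℝ] Matrix ι ι ℂ)

/-- The Sylvester operator of a positive definite matrix is invertible. -/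
def sylvesterEquiv {P : Matrix ι ι ℂ} (hP : P.PosDef) : Matrix ι ι ℂ ≃L[ℝ] Matrix ι ι ℂ :=
  ContinuousLinearEquiv.ofBijective (sylvesterCLM P)
    (LinearMap.ker_eq_bot'.2 fun _ h => eq_zero_of_mul_add_mul_eq_zero hP h)
    (LinearMap.ker_eq_bot_iff_range_eq_top.1
      (LinearMap.ker_eq_bot'.2 fun _ h => eq_zero_of_mul_add_mul_eq_zero hP h))

theorem hasStrictFDerivAt_mul_self (P : Matrix ι ι ℂ) :
    HasStrictFDerivAt (fun Y : Matrix ι ι ℂ => Y * Y) (sylvesterCLM P) P := by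
  have h := (hasStrictFDerivAt_id (𝕜 := ℝ) P).mul' (hasStrictFDerivAt_id (𝕜 := ℝ) P)
  refine HasStrictFDerivAt.congr_fderiv h ?_
  ext1 E
  rfl

/-- The conjugate transpose as a continuous real-linear map. -/
def conjTransposeCLM : Matrix ι ι ℂ →L[ℝ] Matrix ι ι ℂ :=
  LinearMap.toContinuousLinearMap
    { toFun := fun Y => Yᴴ
      map_add' := Matrix.conjTranspose_add
      map_smul' := fun c Y => by simp [Matrix.conjTranspose_smul] }

omit [DecidableEq ι] in
theorem hasFDerivAt_conjTranspose (X : Matrix ι ι ℂ) :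
    HasFDerivAt (fun Y : Matrix ι ι ℂ => Yᴴ) (conjTransposeCLM (ι := ι)) X :=
  conjTransposeCLM.hasFDerivAt (x := X)

theorem differentiableAt_conjTranspose_mul_self (X : Matrix ι ι ℂ) :
    DifferentiableAt ℝ (fun Y : Matrix ι ι ℂ => Yᴴ * Y) X :=
  (hasFDerivAt_conjTranspose X).differentiableAt.mul differentiableAt_id

theorem fderiv_conjTranspose_mul_self (X E : Matrix ι ι ℂ) :
    fderiv ℝ (fun Y : Matrix ι ι ℂ => Yᴴ * Y) X E = Xᴴ * E + Eᴴ * X := by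
  have h := (hasFDerivAt_conjTranspose X).mul' (hasFDerivAt_id (𝕜 := ℝ) X)
  exact congrArg (fun L : Matrix ι ι ℂ →L[ℝ] Matrix ι ι ℂ => L E) h.fderiv

/-- Near `X`, `|Y|` is the local inverse of squaring at `|X|`, applied to `Yᴴ * Y`. -/
theorem differentiableAt_matAbs {X : Matrix ι ι ℂ} (hX : IsUnit X) :
    DifferentiableAt ℝ (matAbs : Matrix ι ι ℂ → Matrix ι ι ℂ) X := by
  have hf : HasStrictFDerivAt (fun Y : Matrix ι ι ℂ => Y * Y)
      (sylvesterEquiv (matAbs_posDef hX) : Matrix ι ι ℂ →L[ℝ] Matrix ι ι ℂ) (matAbs X) :=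
    hasStrictFDerivAt_mul_self _
  have hG := hf.to_localInverse.hasFDerivAt.differentiableAt
  simp only [matAbs_mul_self] at hG
  refine (DifferentiableAt.comp (f := fun Y : Matrix ι ι ℂ => Yᴴ * Y) X hG
    (differentiableAt_conjTranspose_mul_self X)).congr_of_eventuallyEq ?_
  -- Continuity of `matAbs` keeps `|Y|` in the neighbourhood where the local inverse undoes
  -- squaring, so both give the same root.
  filter_upwards [continuous_matAbs.continuousAt.eventually hf.eventually_left_inverse] with Y hY
  simp only [matAbs_mul_self] at hY
  exact hY.symm

theorem matAbs_sylvester {X : Matrix ι ι ℂ} (hX : IsUnit X) (E : Matrix ι ι ℂ) :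
    matAbs X * fderiv ℝ (matAbs : Matrix ι ι ℂ → Matrix ι ι ℂ) X E
      + fderiv ℝ (matAbs : Matrix ι ι ℂ → Matrix ι ι ℂ) X E * matAbs X
      = Xᴴ * E + Eᴴ * X := by
  rw [← fderiv_conjTranspose_mul_self]
  have h := (hasStrictFDerivAt_mul_self (matAbs X)).hasFDerivAt.comp X
    (differentiableAt_matAbs hX).hasFDerivAt
  have h2 : (fun Y : Matrix ι ι ℂ => Y * Y) ∘ matAbs = fun Y => Yᴴ * Y :=
    funext fun Y => matAbs_mul_self Y
  rw [h2] at h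
  rw [h.fderiv]
  rfl

theorem differentiableAt_matSign {X : Matrix ι ι ℂ} (hX : IsUnit X) :
    DifferentiableAt ℝ (matSign : Matrix ι ι ℂ → Matrix ι ι ℂ) X := by
  have h : DifferentiableAt ℝ (fun Y : Matrix ι ι ℂ => (matAbs Y)⁻¹) X := by
    simp only [Matrix.nonsing_inv_eq_ringInverse]
    exact (differentiableAt_inverse (𝕜 := ℝ) (isUnit_matAbs hX)).comp X (differentiableAt_matAbs hX)
  exact differentiableAt_id.mul h

theorem eventually_isUnit {X : Matrix ι ι ℂ} (hX : IsUnit X) : ∀ᶠ Y in nhds X, IsUnit Y :=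
  Units.isOpen.mem_nhds hX

/-- The real part of the trace, as a continuous real-linear functional. -/
def reTraceCLM : Matrix ι ι ℂ →L[ℝ] ℝ :=
  LinearMap.toContinuousLinearMap (Complex.reLm ∘ₗ (Matrix.traceLinearMap ι ℝ ℂ))

theorem differentiableAt_traceNorm {X : Matrix ι ι ℂ} (hX : IsUnit X) :
    DifferentiableAt ℝ (traceNorm : Matrix ι ι ℂ → ℝ) X :=
  reTraceCLM.differentiableAt.comp (f := matAbs) X (differentiableAt_matAbs hX)

theorem fderiv_traceNorm {X : Matrix ι ι ℂ} (hX : IsUnit X) (E : Matrix ι ι ℂ) :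
    fderiv ℝ (traceNorm : Matrix ι ι ℂ → ℝ) X E = (trace ((matSign X)ᴴ * E)).re := by
  have h1 : fderiv ℝ (traceNorm : Matrix ι ι ℂ → ℝ) X E
      = (trace (fderiv ℝ (matAbs : Matrix ι ι ℂ → Matrix ι ι ℂ) X E)).re :=
    congrArg (fun L => L E)
      (reTraceCLM.hasFDerivAt.comp X (differentiableAt_matAbs hX).hasFDerivAt).fderiv
  rw [h1]
  have h2 := matAbs_sylvester hX E
  set D := fderiv ℝ (matAbs : Matrix ι ι ℂ → Matrix ι ι ℂ) X E
  have hu := (Matrix.isUnit_iff_isUnit_det _).1 (isUnit_matAbs hX)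
  -- Under the trace, `|X|⁻¹` cancels both terms of the Sylvester equation, so `trace D` is obtained
  -- without solving for `D`.
  have h3 : trace ((matAbs X)⁻¹ * (matAbs X * D + D * matAbs X)) = 2 * trace D := by
    rw [Matrix.mul_add, Matrix.nonsing_inv_mul_cancel_left _ _ hu, Matrix.trace_add,
      Matrix.trace_mul_comm _ (D * matAbs X), Matrix.mul_nonsing_inv_cancel_right _ _ hu, two_mul]
  have h4 : (matSign X)ᴴ = (matAbs X)⁻¹ * Xᴴ := by
    rw [matSign, Matrix.conjTranspose_mul, Matrix.conjTranspose_nonsing_inv, matAbs_isHermitian]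
  have h5 : trace ((matAbs X)⁻¹ * (Eᴴ * X)) = star (trace ((matSign X)ᴴ * E)) := by
    rw [← Matrix.trace_conjTranspose, Matrix.conjTranspose_mul, Matrix.conjTranspose_conjTranspose,
      matSign, ← Matrix.mul_assoc, Matrix.trace_mul_comm, ← Matrix.mul_assoc,
      Matrix.trace_mul_comm]
  rw [h2, Matrix.mul_add, Matrix.trace_add, h5, ← Matrix.mul_assoc, ← h4] at h3
  have h6 := congrArg Complex.re h3
  simp at h6
  linarith

/-! ### The commutation matrix -/

theorem commMatrix_apply (p q : ι × ι) :
    commMatrix ι p q = if q = p.swap then 1 else 0 := by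
  obtain ⟨a, b⟩ := p
  obtain ⟨c, d⟩ := q
  simp only [commMatrix, Matrix.sum_apply, Matrix.kroneckerMap_apply, Matrix.single_apply,
    Prod.swap_prod_mk, Prod.mk.injEq]
  rw [Finset.sum_eq_single c (fun i _ hi => by simp [hi]) (by simp),
    Finset.sum_eq_single d (fun j _ hj => by simp [hj]) (by simp)]
  by_cases h1 : c = b <;> by_cases h2 : d = a <;> simp [h1, h2]

theorem commMatrix_mulVec (v : ι × ι → ℂ) : commMatrix ι *ᵥ v = v ∘ Prod.swap := by
  ext p
  simp [Matrix.mulVec, dotProduct, commMatrix_apply]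

theorem mul_commMatrix_apply {κ : Type*} (M : Matrix κ (ι × ι) ℂ) (k : κ) (p : ι × ι) :
    (M * commMatrix ι) k p = M k p.swap := by
  have h : ∀ q : ι × ι, p = q.swap ↔ q = p.swap := fun q =>
    ⟨fun h => by rw [h, Prod.swap_swap], fun h => by rw [h, Prod.swap_swap]⟩
  simp [Matrix.mul_apply, commMatrix_apply, h]

/-! ### Derivatives in Hermitian directions -/

/-- Hermitian matrices span all complex matrices. -/
theorem eq_of_mulVec_vec_isHermitian {κ : Type*} {M N : Matrix κ (ι × ι) ℂ}
    (h : ∀ E : Matrix ι ι ℂ, Eᴴ = E → M *ᵥ vec E = N *ᵥ vec E) : M = N := by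
  refine Matrix.ext_of_mulVec_single fun p => ?_
  set X : Matrix ι ι ℂ := Matrix.single p.2 p.1 1
  have hX : Pi.single p (1 : ℂ) = vec X := by
    rw [Matrix.vec_single]
  -- Hermitian and skew-Hermitian parts; the factor `I` makes the second Hermitian, and complex
  -- linearity of `mulVec` absorbs the coefficient.
  have hdec : X = (1 / 2 : ℂ) • (X + Xᴴ) + (-Complex.I / 2) • (Complex.I • (X - Xᴴ)) := by
    rw [smul_smul, show -Complex.I / 2 * Complex.I = 1 / 2 by
      rw [div_mul_eq_mul_div, neg_mul, Complex.I_mul_I, neg_neg], ← smul_add]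
    rw [add_add_sub_cancel, ← two_smul ℂ X, smul_smul]
    norm_num
  have h1 := h (X + Xᴴ) (by simp [add_comm])
  have h2 := h (Complex.I • (X - Xᴴ)) (by simp [Matrix.conjTranspose_smul, ← smul_neg])
  rw [hX, hdec, Matrix.vec_add, Matrix.vec_smul (1 / 2 : ℂ), Matrix.vec_smul (-Complex.I / 2),
    Matrix.mulVec_add, Matrix.mulVec_add, Matrix.mulVec_smul, Matrix.mulVec_smul,
    Matrix.mulVec_smul, Matrix.mulVec_smul, h1, h2]

/-- On Hermitian directions the derivative with respect to a Hermitian argument is the Fréchet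
derivative. -/
theorem hermJac_mulVec_vec {κ : Type*} [Finite κ] (F : Matrix ι ι ℂ → κ → ℂ) (A : Matrix ι ι ℂ)
    {E : Matrix ι ι ℂ} (hE : Eᴴ = E) : hermJac F A *ᵥ vec E = fderiv ℝ F A E := by
  set L := fderiv ℝ F A
  have hdec : E = ∑ p : ι × ι, ((E p.2 p.1).re • Matrix.single p.2 p.1 (1 : ℂ)
      + (E p.2 p.1).im • Matrix.single p.2 p.1 Complex.I) := by
    ext i j
    simp only [Matrix.sum_apply, Matrix.add_apply, Matrix.smul_apply, Matrix.single_apply]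
    rw [Finset.sum_eq_single (j, i)]
    · simp
    · rintro ⟨b, a⟩ - hne
      have : ¬ (a = i ∧ b = j) := fun h => hne (by rw [h.1, h.2])
      simp [this]
    · simp
  ext k
  have hL : L E k = ∑ p : ι × ι, (((E p.2 p.1).re : ℂ) * L (Matrix.single p.2 p.1 (1 : ℂ)) k
      + ((E p.2 p.1).im : ℂ) * L (Matrix.single p.2 p.1 Complex.I) k) := by
    conv_lhs => rw [hdec]
    simp only [map_sum, map_add, map_smul, Finset.sum_apply, Pi.add_apply, Pi.smul_apply,
      Complex.real_smul]
  have hconj : ∀ i j, E j i = star (E i j) := fun i j => by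
    conv_lhs => rw [← hE]
    rfl
  have h1 : ∀ p : ι × ι, hermJac F A k p = jacX F A k p + jacXconj F A k p.swap := fun p => by
    rw [hermJac, Matrix.add_apply, mul_commMatrix_apply]
  -- `K` swaps the two indices; since `E` is Hermitian, the swapped entry is the conjugate one, so
  -- the sum becomes the usual Wirtinger differential.
  have h2 : ∑ p : ι × ι, jacXconj F A k p.swap * vec E p
      = ∑ p : ι × ι, jacXconj F A k p * star (vec E p) := by
    rw [← (Equiv.prodComm ι ι).sum_comp]
    refine Finset.sum_congr rfl fun p _ => ?_
    exact congrArg (jacXconj F A k p * ·) (hconj p.2 p.1)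
  rw [hL]
  simp only [Matrix.mulVec, dotProduct, h1, add_mul, Finset.sum_add_distrib]
  rw [h2, ← Finset.sum_add_distrib, ← Finset.sum_add_distrib]
  refine Finset.sum_congr rfl fun p _ => ?_
  simp only [jacX, jacXconj, Matrix.of_apply, Matrix.vec]
  change 1 / 2 * (L _ k - Complex.I * L _ k) * E p.2 p.1
    + 1 / 2 * (L _ k + Complex.I * L _ k) * (starRingEnd ℂ) (E p.2 p.1) = _
  generalize E p.2 p.1 = z
  have hz : z = z.re + z.im * Complex.I := (Complex.re_add_im z).symm
  have hz' : (starRingEnd ℂ) z = z.re - z.im * Complex.I := by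
    apply Complex.ext <;> simp
  rw [hz']
  generalize (z.re : ℂ) = a at hz ⊢
  generalize (z.im : ℂ) = b at hz ⊢
  rw [hz]
  linear_combination (-b * L (Matrix.single p.2 p.1 Complex.I) k) * Complex.I_mul_I

/-! ### First derivatives of the trace norm -/

theorem fderiv_scalarFun_traceNorm {X : Matrix ι ι ℂ} (hX : IsUnit X) (i j : ι) (c : ℂ) :
    fderiv ℝ (scalarFun traceNorm) X (Matrix.single i j c) ()
      = ((star (matSign X i j) * c).re : ℂ) := by
  have h1 : HasFDerivAt (scalarFun (traceNorm (ι := ι)))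
      (ContinuousLinearMap.pi fun _ : Unit =>
        Complex.ofRealCLM.comp (fderiv ℝ (traceNorm : Matrix ι ι ℂ → ℝ) X)) X :=
    hasFDerivAt_pi.2 fun _ =>
      Complex.ofRealCLM.hasFDerivAt.comp X (differentiableAt_traceNorm hX).hasFDerivAt
  rw [h1.fderiv]
  change ((fderiv ℝ (traceNorm : Matrix ι ι ℂ → ℝ) X (Matrix.single i j c) : ℝ) : ℂ) = _
  rw [fderiv_traceNorm hX, Matrix.trace_mul_single]
  simp [mul_comm]

theorem gradX_traceNorm {X : Matrix ι ι ℂ} (hX : IsUnit X) (p : ι × ι) :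
    gradX traceNorm X p = (1 / 2 : ℂ) * star (matSign X p.2 p.1) := by
  rw [gradX, jacX, Matrix.of_apply, fderiv_scalarFun_traceNorm hX, fderiv_scalarFun_traceNorm hX]
  congr 1
  apply Complex.ext <;> simp

theorem gradXconj_traceNorm {X : Matrix ι ι ℂ} (hX : IsUnit X) (p : ι × ι) :
    gradXconj traceNorm X p = (1 / 2 : ℂ) * matSign X p.2 p.1 := by
  rw [gradXconj, jacXconj, Matrix.of_apply, fderiv_scalarFun_traceNorm hX,
    fderiv_scalarFun_traceNorm hX]
  congr 1
  apply Complex.ext <;> simp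

/-- This is the entry `(p.1, p.2)` of the Hermitian part of `sign X`. As `vec` reads entry `(p.2,
p.1)` at `p`, the swap is the source of the factor `K` in the Hessian. -/
theorem hermGrad_traceNorm {X : Matrix ι ι ℂ} (hX : IsUnit X) (p : ι × ι) :
    hermGrad traceNorm X p
      = (1 / 2 : ℂ) * star (matSign X p.2 p.1) + (1 / 2 : ℂ) * matSign X p.1 p.2 := by
  rw [hermGrad, hermJac, Matrix.add_apply, mul_commMatrix_apply]
  exact congrArg₂ (· + ·) (gradX_traceNorm hX p) (gradXconj_traceNorm hX p.swap)

theorem hasFDerivAt_matSign_apply {X : Matrix ι ι ℂ} (hX : IsUnit X) (i j : ι) :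
    HasFDerivAt (fun Y : Matrix ι ι ℂ => matSign Y i j)
      ((LinearMap.toContinuousLinearMap (Matrix.entryLinearMap ℝ ℂ i j)).comp
        (fderiv ℝ (matSign : Matrix ι ι ℂ → Matrix ι ι ℂ) X)) X :=
  (LinearMap.toContinuousLinearMap (Matrix.entryLinearMap ℝ ℂ i j)).hasFDerivAt.comp
    (f := matSign) X (differentiableAt_matSign hX).hasFDerivAt

theorem twiceDifferentiableAt_traceNorm {A : Matrix ι ι ℂ} (hA : IsUnit A) :
    TwiceDifferentiableAt traceNorm A := by
  refine ⟨(eventually_isUnit hA).mono fun X hX => differentiableAt_traceNorm hX, ?_, ?_⟩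
  · refine DifferentiableAt.congr_of_eventuallyEq
      (f := fun X (p : ι × ι) => (1 / 2 : ℂ) * star (matSign X p.2 p.1)) ?_
      ((eventually_isUnit hA).mono fun X hX => funext fun p => gradX_traceNorm hX p)
    exact differentiableAt_pi.2 fun p =>
      ((hasFDerivAt_matSign_apply hA p.2 p.1).star.differentiableAt).const_mul _
  · refine DifferentiableAt.congr_of_eventuallyEq
      (f := fun X (p : ι × ι) => (1 / 2 : ℂ) * matSign X p.2 p.1) ?_
      ((eventually_isUnit hA).mono fun X hX => funext fun p => gradXconj_traceNorm hX p)
    exact differentiableAt_pi.2 fun p =>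
      ((hasFDerivAt_matSign_apply hA p.2 p.1).differentiableAt).const_mul _

theorem fderiv_hermGrad_traceNorm {A : Matrix ι ι ℂ} (hA : IsUnit A) (E : Matrix ι ι ℂ)
    (p : ι × ι) :
    fderiv ℝ (hermGrad traceNorm) A E p
      = (1 / 2 : ℂ) * star (fderiv ℝ (matSign : Matrix ι ι ℂ → Matrix ι ι ℂ) A E p.2 p.1)
        + (1 / 2 : ℂ) * fderiv ℝ (matSign : Matrix ι ι ℂ → Matrix ι ι ℂ) A E p.1 p.2 := by
  have h := hasFDerivAt_pi.2 fun p : ι × ι =>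
    ((hasFDerivAt_matSign_apply hA p.2 p.1).star.const_mul (1 / 2 : ℂ)).add
      ((hasFDerivAt_matSign_apply hA p.1 p.2).const_mul (1 / 2 : ℂ))
  have h2 := h.congr_of_eventuallyEq (f₁ := hermGrad traceNorm)
      ((eventually_isUnit hA).mono fun X hX => funext fun p => hermGrad_traceNorm hX p)
  rw [h2.fderiv]
  rfl

/-! ### The derivative of the matrix sign at a Hermitian matrix -/

theorem commute_matAbs {A : Matrix ι ι ℂ} (hA : Aᴴ = A) : matAbs A * A = A * matAbs A :=
  CFC.commute_abs_self A (IsSelfAdjoint.isStarNormal hA)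

theorem matAbs_mul_matSign {A : Matrix ι ι ℂ} (hA : Aᴴ = A) (hu : IsUnit A) :
    matAbs A * matSign A = A := by
  rw [matSign, ← Matrix.mul_assoc, commute_matAbs hA]
  exact Matrix.mul_nonsing_inv_cancel_right _ _
    ((Matrix.isUnit_iff_isUnit_det _).1 (isUnit_matAbs hu))

theorem matSign_eq_inv_mul {A : Matrix ι ι ℂ} (hA : Aᴴ = A) (hu : IsUnit A) :
    matSign A = (matAbs A)⁻¹ * A := by
  have h := Matrix.nonsing_inv_mul_cancel_left (matAbs A) (matSign A)
    ((Matrix.isUnit_iff_isUnit_det _).1 (isUnit_matAbs hu))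
  rwa [matAbs_mul_matSign hA hu, eq_comm] at h

theorem matSign_isHermitian {A : Matrix ι ι ℂ} (hA : Aᴴ = A) (hu : IsUnit A) :
    (matSign A)ᴴ = matSign A := by
  rw [matSign_eq_inv_mul hA hu, Matrix.conjTranspose_mul, Matrix.conjTranspose_nonsing_inv,
    matAbs_isHermitian, hA, ← matSign_eq_inv_mul hA hu, matSign]

theorem matSign_mul_self {A : Matrix ι ι ℂ} (hA : Aᴴ = A) (hu : IsUnit A) :
    matSign A * A = matAbs A := by
  rw [matSign_eq_inv_mul hA hu, Matrix.mul_assoc]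
  -- One factor `A` becomes `Aᴴ`, so that `A * A` matches `|A| * |A| = Aᴴ * A`.
  conv_lhs => enter [2, 1]; rw [← hA]
  rw [← matAbs_mul_self]
  exact Matrix.nonsing_inv_mul_cancel_left _ _
    ((Matrix.isUnit_iff_isUnit_det _).1 (isUnit_matAbs hu))

theorem fderiv_matSign_mul_matAbs {A : Matrix ι ι ℂ} (hu : IsUnit A) (E : Matrix ι ι ℂ) :
    matSign A * fderiv ℝ (matAbs : Matrix ι ι ℂ → Matrix ι ι ℂ) A E
      + fderiv ℝ (matSign : Matrix ι ι ℂ → Matrix ι ι ℂ) A E * matAbs A = E := by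
  have h := (differentiableAt_matSign hu).hasFDerivAt.mul' (differentiableAt_matAbs hu).hasFDerivAt
  have h2 := (hasFDerivAt_id (𝕜 := ℝ) A).congr_of_eventuallyEq (f₁ := matSign * matAbs)
    ((eventually_isUnit hu).mono fun X hX => matSign_mul_matAbs hX)
  exact congrArg (fun L : Matrix ι ι ℂ →L[ℝ] Matrix ι ι ℂ => L E) (h.unique h2)

/-- The product rule for `X = (sign X) |X|` gives `T P = E - S D`; the Sylvester equation for `D`
then eliminates `D`, because `P S = S P = A` and `S A = P`. -/
theorem matSign_sylvester {A E : Matrix ι ι ℂ} (hA : Aᴴ = A) (hu : IsUnit A) (hE : Eᴴ = E) :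
    matAbs A * fderiv ℝ (matSign : Matrix ι ι ℂ → Matrix ι ι ℂ) A E
      + fderiv ℝ (matSign : Matrix ι ι ℂ → Matrix ι ι ℂ) A E * matAbs A
      = E - matSign A * E * matSign A := by
  have h1 := matAbs_sylvester hu E
  have h2 := fderiv_matSign_mul_matAbs hu E
  rw [hA, hE] at h1
  have h3 := matAbs_mul_matSign hA hu
  have h4 := matSign_mul_matAbs hu
  have h5 := matSign_mul_self hA hu
  set D := fderiv ℝ (matAbs : Matrix ι ι ℂ → Matrix ι ι ℂ) A E
  set T := fderiv ℝ (matSign : Matrix ι ι ℂ → Matrix ι ι ℂ) A E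
  set P := matAbs A
  set S := matSign A
  -- An extra `P` on the right makes `T` occur only through `T P`.
  refine (isUnit_matAbs hu).mul_right_cancel ?_
  have h6 : T * P = E - S * D := by rw [← h2]; abel
  have h7 : S * (P * D + D * P) = P * E + S * E * A := by
    rw [h1, Matrix.mul_add, ← Matrix.mul_assoc, h5, Matrix.mul_assoc]
  calc (P * T + T * P) * P = P * (T * P) + (T * P) * P := by noncomm_ring
    _ = P * E + E * P - (P * S * D + S * (D * P)) := by rw [h6]; noncomm_ring
    _ = P * E + E * P - S * (P * D + D * P) := by rw [h3, ← h4]; noncomm_ring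
    _ = (E - S * E * S) * P := by
      rw [h7, sub_mul, Matrix.mul_assoc _ S P, h4]; abel

/-- `T` and `Tᴴ` solve the same Sylvester equation, whose right-hand side is Hermitian. -/
theorem fderiv_matSign_isHermitian {A E : Matrix ι ι ℂ} (hA : Aᴴ = A) (hu : IsUnit A)
    (hE : Eᴴ = E) :
    (fderiv ℝ (matSign : Matrix ι ι ℂ → Matrix ι ι ℂ) A E)ᴴ
      = fderiv ℝ (matSign : Matrix ι ι ℂ → Matrix ι ι ℂ) A E := by
  have h := matSign_sylvester hA hu hE
  have h' := congrArg Matrix.conjTranspose h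
  simp only [Matrix.conjTranspose_add, Matrix.conjTranspose_sub, Matrix.conjTranspose_mul,
    matAbs_isHermitian, matSign_isHermitian hA hu, hE] at h'
  rw [← Matrix.mul_assoc, ← h, add_comm] at h'
  refine sub_eq_zero.1 (eq_zero_of_mul_add_mul_eq_zero (matAbs_posDef hu) ?_)
  rw [mul_sub, sub_mul, sub_add_sub_comm, h', sub_self]

/-- The Hessian of the trace norm in terms of the absolute value and the sign. -/
theorem hermHessian_traceNorm {A : Matrix ι ι ℂ} (hA : Aᴴ = A) (hu : IsUnit A) :
    hermHessian traceNorm A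
      = commMatrix ι * ((kronSelf (matAbs A))⁻¹ * (1 - (matSign A)ᵀ ⊗ₖ matSign A)) := by
  have hK := (Matrix.isUnit_iff_isUnit_det _).1 (kronSelf_posDef (matAbs_posDef hu)).isUnit
  refine eq_of_mulVec_vec_isHermitian fun E hE => ?_
  set T := fderiv ℝ (matSign : Matrix ι ι ℂ → Matrix ι ι ℂ) A E with hT
  have h1 : hermHessian traceNorm A *ᵥ vec E = commMatrix ι *ᵥ vec T := by
    rw [hermHessian, hermJac_mulVec_vec _ _ hE, commMatrix_mulVec]
    ext p
    rw [fderiv_hermGrad_traceNorm hu, ← hT]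
    have h : star (T p.2 p.1) = T p.1 p.2 := by
      conv_rhs => rw [hT, ← fderiv_matSign_isHermitian hA hu hE]
      rfl
    rw [h, ← add_mul]
    norm_num [Matrix.vec]
  have h2 : kronSelf (matAbs A) *ᵥ vec T = (1 - (matSign A)ᵀ ⊗ₖ matSign A) *ᵥ vec E := by
    rw [kronSelf_mulVec_vec, matSign_sylvester hA hu hE, Matrix.vec_sub, Matrix.sub_mulVec,
      Matrix.one_mulVec, kronecker_mulVec_vec, Matrix.transpose_transpose]
  rw [h1, ← Matrix.mulVec_mulVec, ← Matrix.mulVec_mulVec, ← h2, Matrix.mulVec_mulVec _ _⁻¹,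
    Matrix.nonsing_inv_mul _ hK, Matrix.one_mulVec]

/-! ### Unitary conjugation -/

theorem matAbs_unitary_conj {U : Matrix ι ι ℂ} (hU : U ∈ Matrix.unitaryGroup ι ℂ)
    (X : Matrix ι ι ℂ) : matAbs (U * X * Uᴴ) = U * matAbs X * Uᴴ := by
  have hU' : Uᴴ * U = 1 := Matrix.mem_unitaryGroup_iff'.1 hU
  refine matAbs_eq_of_mul_self ((matAbs_posSemidef X).mul_mul_conjTranspose_same U) ?_
  calc U * matAbs X * Uᴴ * (U * matAbs X * Uᴴ)
      = U * matAbs X * (Uᴴ * U) * matAbs X * Uᴴ := by simp only [Matrix.mul_assoc]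
    _ = U * (matAbs X * matAbs X) * Uᴴ := by rw [hU', Matrix.mul_one]; simp only [Matrix.mul_assoc]
    _ = U * Xᴴ * (Uᴴ * U) * X * Uᴴ := by
      rw [matAbs_mul_self, hU', Matrix.mul_one]; simp only [Matrix.mul_assoc]
    _ = (U * X * Uᴴ)ᴴ * (U * X * Uᴴ) := by
      simp only [Matrix.conjTranspose_mul, Matrix.conjTranspose_conjTranspose, Matrix.mul_assoc]

theorem inv_conj {κ : Type*} [Fintype κ] [DecidableEq κ] {V W : Matrix κ κ ℂ} (h : V * W = 1)
    (X : Matrix κ κ ℂ) : (V * X * W)⁻¹ = V * X⁻¹ * W := by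
  rw [Matrix.mul_inv_rev, Matrix.mul_inv_rev, Matrix.inv_eq_right_inv h, Matrix.inv_eq_left_inv h,
    Matrix.mul_assoc]

theorem conj_mul_conj {κ : Type*} [Fintype κ] [DecidableEq κ] {V W : Matrix κ κ ℂ} (h : W * V = 1)
    (X Y : Matrix κ κ ℂ) : V * X * W * (V * Y * W) = V * (X * Y) * W := by
  calc V * X * W * (V * Y * W) = V * X * (W * V) * Y * W := by simp only [Matrix.mul_assoc]
    _ = V * (X * Y) * W := by rw [h, Matrix.mul_one]; simp only [Matrix.mul_assoc]

theorem matSign_unitary_conj {U : Matrix ι ι ℂ} (hU : U ∈ Matrix.unitaryGroup ι ℂ)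
    (X : Matrix ι ι ℂ) : matSign (U * X * Uᴴ) = U * matSign X * Uᴴ := by
  have hU' : U * Uᴴ = 1 := Matrix.mem_unitaryGroup_iff.1 hU
  rw [matSign, matAbs_unitary_conj hU, inv_conj hU', conj_mul_conj (mul_eq_one_comm.1 hU'), matSign]

omit [DecidableEq ι] in
theorem transpose_conj_kronecker_conj (U X Y : Matrix ι ι ℂ) :
    (U * X * Uᴴ)ᵀ ⊗ₖ (U * Y * Uᴴ) = (U.map star ⊗ₖ U) * (Xᵀ ⊗ₖ Y) * (Uᵀ ⊗ₖ Uᴴ) := by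
  rw [← Matrix.mul_kronecker_mul, ← Matrix.mul_kronecker_mul, Matrix.transpose_mul,
    Matrix.transpose_mul, ← Matrix.mul_assoc]
  rfl

theorem map_star_kronecker_mul {U : Matrix ι ι ℂ} (hU : U ∈ Matrix.unitaryGroup ι ℂ) :
    (U.map star ⊗ₖ U) * (Uᵀ ⊗ₖ Uᴴ) = 1 := by
  have h := transpose_conj_kronecker_conj U 1 1
  have hU' : U * Uᴴ = 1 := Matrix.mem_unitaryGroup_iff.1 hU
  simpa [hU'] using h.symm

theorem kronecker_mul_map_star {U : Matrix ι ι ℂ} (hU : U ∈ Matrix.unitaryGroup ι ℂ) :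
    (Uᵀ ⊗ₖ Uᴴ) * (U.map star ⊗ₖ U) = 1 :=
  mul_eq_one_comm.1 (map_star_kronecker_mul hU)

theorem kronSelf_unitary_conj {U : Matrix ι ι ℂ} (hU : U ∈ Matrix.unitaryGroup ι ℂ)
    (X : Matrix ι ι ℂ) :
    kronSelf (U * X * Uᴴ) = (U.map star ⊗ₖ U) * kronSelf X * (Uᵀ ⊗ₖ Uᴴ) := by
  have hU' : U * Uᴴ = 1 := Matrix.mem_unitaryGroup_iff.1 hU
  have h1 := transpose_conj_kronecker_conj U X 1
  have h2 := transpose_conj_kronecker_conj U 1 X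
  rw [Matrix.mul_one, hU'] at h1 h2
  rw [Matrix.transpose_one] at h2
  rw [kronSelf, kronSum, h1, h2, kronSelf, kronSum, Matrix.mul_add, Matrix.add_mul]

/-! ### Diagonal matrices -/

theorem inv_diagonal_of_ne_zero {κ : Type*} [Fintype κ] [DecidableEq κ] {d : κ → ℂ}
    (hd : ∀ k, d k ≠ 0) : (diagonal d)⁻¹ = diagonal fun k => (d k)⁻¹ := by
  refine Matrix.inv_eq_right_inv ?_
  rw [Matrix.diagonal_mul_diagonal, ← Matrix.diagonal_one]
  exact congrArg diagonal (funext fun k => mul_inv_cancel₀ (hd k))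

theorem ne_zero_of_isUnit_diagonal {d : ι → ℂ} (h : IsUnit (diagonal d)) (i : ι) : d i ≠ 0 :=
  ((Pi.isUnit_iff.1 (Matrix.isUnit_diagonal.1 h)) i).ne_zero

theorem matAbs_diagonal (x : ι → ℝ) :
    matAbs (diagonal fun i => (x i : ℂ)) = diagonal fun i => ((|x i| : ℝ) : ℂ) := by
  refine matAbs_eq_of_mul_self (Matrix.PosSemidef.diagonal fun i => ?_) ?_
  · exact Complex.zero_le_real.2 (abs_nonneg _)
  · rw [Matrix.diagonal_conjTranspose, Matrix.diagonal_mul_diagonal, Matrix.diagonal_mul_diagonal]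
    congr 1
    ext i
    simp only [Pi.star_apply, Complex.star_def, Complex.conj_ofReal]
    rw [← Complex.ofReal_mul, ← Complex.ofReal_mul, abs_mul_abs_self]

theorem matSign_diagonal {x : ι → ℝ} (hx : ∀ i, x i ≠ 0) :
    matSign (diagonal fun i => (x i : ℂ))
      = diagonal fun i => (x i : ℂ) * ((|x i| : ℝ) : ℂ)⁻¹ := by
  rw [matSign, matAbs_diagonal, inv_diagonal_of_ne_zero, Matrix.diagonal_mul_diagonal]
  exact fun i => Complex.ofReal_ne_zero.2 (abs_ne_zero.2 (hx i))

omit [Fintype ι] in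
theorem kronSum_diagonal (x y : ι → ℂ) :
    kronSum (diagonal x) (diagonal y) = diagonal fun p : ι × ι => x p.1 + y p.2 := by
  rw [kronSum, ← Matrix.diagonal_one, Matrix.diagonal_kronecker_diagonal,
    Matrix.diagonal_kronecker_diagonal, Matrix.diagonal_add]
  simp

omit [Fintype ι] in
theorem kronSelf_diagonal (x : ι → ℂ) :
    kronSelf (diagonal x) = diagonal fun p : ι × ι => x p.1 + x p.2 := by
  rw [kronSelf, Matrix.diagonal_transpose, kronSum_diagonal]

/-- The right side is `((|x| + |y|)² - (x + y)²) / (2 |x| |y| (|x| + |y|))`, and the difference of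
squares equals `2 (|x| |y| - x y)`. -/
theorem hessian_entry_identity {x y : ℝ} (hx : x ≠ 0) (hy : y ≠ 0) :
    (|x| + |y|)⁻¹ * (1 - x * |x|⁻¹ * (y * |y|⁻¹))
      = 1 / 2 * (|x|⁻¹ + |y|⁻¹
        - (x + y) * (|x| + |y|)⁻¹ * (|x|⁻¹ + |y|⁻¹) * (|x| + |y|)⁻¹ * (x + y)) := by
  have h1 : |x| ≠ 0 := abs_ne_zero.2 hx
  have h2 : |y| ≠ 0 := abs_ne_zero.2 hy
  have h3 : |x| + |y| ≠ 0 := by positivity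
  have hx2 : x ^ 2 = |x| ^ 2 := (sq_abs x).symm
  have hy2 : y ^ 2 = |y| ^ 2 := (sq_abs y).symm
  field_simp
  linear_combination (|x| + |y|) * hx2 + (|x| + |y|) * hy2

/-! ### The two formulas for the Hessian -/

section Eigendecomposition

variable {U : Matrix ι ι ℂ} {x : ι → ℝ}

theorem isUnit_of_isUnit_unitary_conj (hU : U ∈ Matrix.unitaryGroup ι ℂ) {X : Matrix ι ι ℂ}
    (h : IsUnit (U * X * Uᴴ)) : IsUnit X := by
  have hU' : Uᴴ * U = 1 := Matrix.mem_unitaryGroup_iff'.1 hU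
  have h1 : IsUnit U := (Matrix.isUnit_iff_isUnit_det U).2 (Matrix.UnitaryGroup.det_isUnit ⟨U, hU⟩)
  have h2 : X = Uᴴ * (U * X * Uᴴ) * U := by
    calc X = (Uᴴ * U) * X * (Uᴴ * U) := by rw [hU', Matrix.one_mul, Matrix.mul_one]
      _ = _ := by simp only [Matrix.mul_assoc]
  rw [h2]
  exact (h1.star.mul h).mul h1

/-- The Hessian at a matrix with a given eigendecomposition. -/
theorem hermHessian_traceNorm_unitary_conj (hU : U ∈ Matrix.unitaryGroup ι ℂ)
    (hx : ∀ i, x i ≠ 0) (hu : IsUnit (U * diagonal (fun i => (x i : ℂ)) * Uᴴ)) :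
    hermHessian traceNorm (U * diagonal (fun i => (x i : ℂ)) * Uᴴ)
      = commMatrix ι * ((U.map star ⊗ₖ U) * (diagonal fun p : ι × ι =>
          (((|x p.1| + |x p.2|)⁻¹ * (1 - x p.1 * |x p.1|⁻¹ * (x p.2 * |x p.2|⁻¹)) : ℝ) : ℂ))
        * (Uᵀ ⊗ₖ Uᴴ)) := by
  have hH : (U * diagonal (fun i => (x i : ℂ)) * Uᴴ)ᴴ = U * diagonal (fun i => (x i : ℂ)) * Uᴴ := by
    rw [Matrix.conjTranspose_mul, Matrix.conjTranspose_mul, Matrix.conjTranspose_conjTranspose,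
      Matrix.diagonal_conjTranspose, Matrix.mul_assoc]
    congr 3
    ext i
    simp
  have hW := map_star_kronecker_mul hU
  rw [hermHessian_traceNorm hH hu, matAbs_unitary_conj hU, matSign_unitary_conj hU,
    kronSelf_unitary_conj hU, transpose_conj_kronecker_conj, inv_conj hW]
  -- The identity is written as a conjugate too, so the difference can be taken inside the
  -- conjugation.
  have h1 : (1 : Matrix (ι × ι) (ι × ι) ℂ) = (U.map star ⊗ₖ U) * 1 * (Uᵀ ⊗ₖ Uᴴ) := by
    rw [Matrix.mul_one, hW]
  rw [h1, ← Matrix.sub_mul, ← Matrix.mul_sub, conj_mul_conj (kronecker_mul_map_star hU),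
    matAbs_diagonal, matSign_diagonal hx, kronSelf_diagonal, inv_diagonal_of_ne_zero,
    Matrix.diagonal_transpose, Matrix.diagonal_kronecker_diagonal, ← Matrix.diagonal_one,
    Matrix.diagonal_sub, Matrix.diagonal_mul_diagonal]
  · push_cast
    rfl
  · intro p
    rw [← Complex.ofReal_add]
    exact Complex.ofReal_ne_zero.2
      (add_pos (abs_pos.2 (hx p.1)) (abs_pos.2 (hx p.2))).ne'

/-- Diagonal matrices commute and equal their transposes, so neither the order of the factors nor
the transpose on the sign matters. -/
theorem hermHessian_traceNorm_eigen (hU : U ∈ Matrix.unitaryGroup ι ℂ)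
    (hx : ∀ i, x i ≠ 0) (hu : IsUnit (U * diagonal (fun i => (x i : ℂ)) * Uᴴ)) :
    hermHessian traceNorm (U * diagonal (fun i => (x i : ℂ)) * Uᴴ)
      = commMatrix ι * (U.map star ⊗ₖ U) *
          (1 - matSign (diagonal fun i => (x i : ℂ)) ⊗ₖ matSign (diagonal fun i => (x i : ℂ))) *
          (kronSum (matAbs (diagonal fun i => (x i : ℂ)))
            (matAbs (diagonal fun i => (x i : ℂ))))⁻¹ * (Uᵀ ⊗ₖ Uᴴ) := by
  rw [hermHessian_traceNorm_unitary_conj hU hx hu, matAbs_diagonal, matSign_diagonal hx,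
    kronSum_diagonal, inv_diagonal_of_ne_zero, Matrix.diagonal_kronecker_diagonal,
    ← Matrix.diagonal_one, Matrix.diagonal_sub, Matrix.mul_assoc (commMatrix ι * _),
    Matrix.diagonal_mul_diagonal, ← Matrix.mul_assoc, ← Matrix.mul_assoc]
  · congr 3
    ext p
    push_cast
    ring
  · intro p
    rw [← Complex.ofReal_add]
    exact Complex.ofReal_ne_zero.2
      (add_pos (abs_pos.2 (hx p.1)) (abs_pos.2 (hx p.2))).ne'

/-- Every factor is a conjugate of a diagonal matrix by the same `U* ⊗ U`, so the claim reduces to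
`hessian_entry_identity` in each diagonal entry. -/
theorem hermHessian_traceNorm_kronSelf (hU : U ∈ Matrix.unitaryGroup ι ℂ)
    (hx : ∀ i, x i ≠ 0) {A : Matrix ι ι ℂ} (hA : A = U * diagonal (fun i => (x i : ℂ)) * Uᴴ)
    (hu : IsUnit A) :
    hermHessian traceNorm A
      = (1 / 2 : ℂ) • (commMatrix ι * (kronSelf (matAbs A)⁻¹ -
            kronSelf A * (kronSelf (matAbs A))⁻¹ * kronSelf (matAbs A)⁻¹ *
              (kronSelf (matAbs A))⁻¹ * kronSelf A)) := by
  have hU' : U * Uᴴ = 1 := Matrix.mem_unitaryGroup_iff.1 hU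
  have hW := map_star_kronecker_mul hU
  have hW' := kronecker_mul_map_star hU
  have hx' : ∀ i, ((|x i| : ℝ) : ℂ) ≠ 0 := fun i => Complex.ofReal_ne_zero.2 (abs_ne_zero.2 (hx i))
  have hxx : ∀ p : ι × ι, ((|x p.1| : ℝ) : ℂ) + ((|x p.2| : ℝ) : ℂ) ≠ 0 := fun p => by
    rw [← Complex.ofReal_add]
    exact Complex.ofReal_ne_zero.2 (add_pos (abs_pos.2 (hx p.1)) (abs_pos.2 (hx p.2))).ne'
  subst hA
  rw [hermHessian_traceNorm_unitary_conj hU hx hu, matAbs_unitary_conj hU,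
    inv_conj hU', kronSelf_unitary_conj hU, kronSelf_unitary_conj hU,
    kronSelf_unitary_conj hU, inv_conj hW, conj_mul_conj hW', conj_mul_conj hW', conj_mul_conj hW',
    conj_mul_conj hW', ← Matrix.sub_mul, ← Matrix.mul_sub, matAbs_diagonal,
    inv_diagonal_of_ne_zero hx', kronSelf_diagonal, kronSelf_diagonal, kronSelf_diagonal,
    inv_diagonal_of_ne_zero hxx]
  simp only [Matrix.diagonal_mul_diagonal, Matrix.diagonal_sub]
  rw [← Matrix.mul_smul, ← Matrix.smul_mul, ← Matrix.mul_smul, ← Matrix.diagonal_smul]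
  congr 4
  ext p
  rw [hessian_entry_identity (hx p.1) (hx p.2)]
  simp

end Eigendecomposition

end TraceNormHessian

end

theorem mainTheorem2 {n : ℕ} (A : Matrix (Fin n) (Fin n) ℂ) (hA : A.IsHermitian)
    (hinv : IsUnit A) :
    -- the second derivatives of the trace norm at `A` exist
    TraceNormHessian.TwiceDifferentiableAt TraceNormHessian.traceNorm A ∧
    -- the formula through an eigendecomposition `A = U Λ U†`
    (∀ (U : Matrix (Fin n) (Fin n) ℂ) (eig : Fin n → ℝ) (Lam : Matrix (Fin n) (Fin n) ℂ),
      U ∈ Matrix.unitaryGroup (Fin n) ℂ →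
      Lam = Matrix.diagonal (fun i => (eig i : ℂ)) →
      A = U * Lam * Uᴴ →
      IsUnit (TraceNormHessian.matAbs Lam) ∧
      IsUnit (TraceNormHessian.kronSum (TraceNormHessian.matAbs Lam)
        (TraceNormHessian.matAbs Lam)) ∧
      TraceNormHessian.hermHessian TraceNormHessian.traceNorm A =
        TraceNormHessian.commMatrix (Fin n) * (U.map star ⊗ₖ U) *
          (1 - TraceNormHessian.matSign Lam ⊗ₖ TraceNormHessian.matSign Lam) *
          (TraceNormHessian.kronSum (TraceNormHessian.matAbs Lam)
            (TraceNormHessian.matAbs Lam))⁻¹ * (Uᵀ ⊗ₖ Uᴴ)) ∧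
    -- the formula in terms of `A` and `|A|`
    (IsUnit (TraceNormHessian.matAbs A) ∧
      IsUnit (TraceNormHessian.kronSelf (TraceNormHessian.matAbs A)) ∧
      TraceNormHessian.hermHessian TraceNormHessian.traceNorm A =
        (1 / 2 : ℂ) • (TraceNormHessian.commMatrix (Fin n) *
          (TraceNormHessian.kronSelf (TraceNormHessian.matAbs A)⁻¹ -
            TraceNormHessian.kronSelf A *
              (TraceNormHessian.kronSelf (TraceNormHessian.matAbs A))⁻¹ *
              TraceNormHessian.kronSelf (TraceNormHessian.matAbs A)⁻¹ *
              (TraceNormHessian.kronSelf (TraceNormHessian.matAbs A))⁻¹ *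
              TraceNormHessian.kronSelf A))) ∧
    -- the Hessian vanishes when all eigenvalues are positive
    ((∀ i, 0 < hA.eigenvalues i) →
      TraceNormHessian.hermHessian TraceNormHessian.traceNorm A = 0) := by
  refine ⟨TraceNormHessian.twiceDifferentiableAt_traceNorm hinv, ?_,
    ⟨TraceNormHessian.isUnit_matAbs hinv,
      (TraceNormHessian.kronSelf_posDef (TraceNormHessian.matAbs_posDef hinv)).isUnit, ?_⟩, ?_⟩
  · rintro U eig Lam hU rfl rfl
    have hL := TraceNormHessian.isUnit_of_isUnit_unitary_conj hU hinv
    have heig : ∀ i, eig i ≠ 0 := fun i =>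
      Complex.ofReal_ne_zero.1 (TraceNormHessian.ne_zero_of_isUnit_diagonal hL i)
    refine ⟨TraceNormHessian.isUnit_matAbs hL, ?_,
      TraceNormHessian.hermHessian_traceNorm_eigen hU heig hinv⟩
    have hP := TraceNormHessian.matAbs_posDef hL
    exact ((hP.kronecker Matrix.PosDef.one).add (Matrix.PosDef.one.kronecker hP)).isUnit
  -- The second formula does not involve a basis; any eigendecomposition serves to prove it, here
  -- the spectral theorem's.
  · have hU := hA.eigenvectorUnitary.2
    have hspec : A = (hA.eigenvectorUnitary : Matrix (Fin n) (Fin n) ℂ)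
        * Matrix.diagonal (fun i => (hA.eigenvalues i : ℂ))
        * (hA.eigenvectorUnitary : Matrix (Fin n) (Fin n) ℂ)ᴴ := hA.spectral_theorem
    refine TraceNormHessian.hermHessian_traceNorm_kronSelf hU (fun i => ?_) hspec hinv
    have h := hinv
    rw [hspec] at h
    exact Complex.ofReal_ne_zero.1 (TraceNormHessian.ne_zero_of_isUnit_diagonal
      (TraceNormHessian.isUnit_of_isUnit_unitary_conj hU h) i)
  · intro hpos
    have hP : A.PosDef := hA.posDef_iff_eigenvalues_pos.2 hpos
    have habs : TraceNormHessian.matAbs A = A :=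
      TraceNormHessian.matAbs_eq_of_mul_self hP.posSemidef (by rw [hA.eq])
    have hsign : TraceNormHessian.matSign A = 1 := by
      rw [TraceNormHessian.matSign, habs,
        Matrix.mul_nonsing_inv _ ((Matrix.isUnit_iff_isUnit_det _).1 hinv)]
    rw [TraceNormHessian.hermHessian_traceNorm hA.eq hinv, hsign, Matrix.transpose_one,
      Matrix.one_kronecker_one, sub_self, Matrix.mul_zero, Matrix.mul_zero]
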